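/- Let $m$ be a positive integer. A model of $T_m$ is a set $M$ together with a function $\mathrm{Sel}$ assigning to every $m$-element subset $X\subseteq M$ an element $\mathrm{Sel}(X)\in X$; submodels are subsets with the restricted function, and an isomorphism is a bijection $e$ with $e(\mathrm{Sel}(X))=\mathrm{Sel}(e[X])$ for all $m$-element sets $X$. There exists a model $\mathbf F$ of $T_m$ with domain $\omega$ such that (i) every nonempty finite model of $T_m$ is isomorphic to infinitely many submodels of $\mathbf F$, and (ii) every isomorphism between two finite submodels of $\mathbf F$ extends to an automorphism of $\mathbf F$. For any such $\mathbf F$, work in the universe of sets over the set of atoms $A=\omega$ (the domain of $\mathbf F$), let $G$ be the group of all permutations $\pi$ of $A$ with $\pi(\mathrm{Sel}(X))=\mathrm{Sel}(\pi[X])$ for every $m$-element $X\subseteq A$, and let $\mathcal V_m$ be the permutation model determined by $G$ and the normal ideal of finite subsets of $A$, i.e. the class of all hereditarily symmetric objects, where $x$ is symmetric if there is a finite $S\subseteq A$ such that every $\pi\in G$ fixing $S$ pointwise satisfies $\pi x=x$. Then $\mathcal V_m$ satisfies $\mathsf{RC}_m$: in $\mathcal V_m$, every infinite set $X$ has an infinite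 subset $Y\subseteq X$ such that the set $[Y]^m$ of $m$-element subsets of $Y$ has a choice function. -/

import Mathlib

universe u

/-! ### Models of the theory of a selector on `m`-element sets -/

/-- A model of `T_m` with domain `M`: a function selecting an element from every `m`-element
subset of `M`. -/
structure Selector (m : ℕ) (M : Type*) where
  sel : (s : Finset M) → s.card = m → M
  sel_mem : ∀ (s : Finset M) (h : s.card = m), sel s h ∈ s

namespace Selector

variable {m : ℕ} {M N : Type*}

/-- The submodel with domain `s`. -/
def restrict (F : Selector m M) (s : Finset M) : Selector m s where
  sel t h := ⟨F.sel (t.map (Function.Embedding.subtype _)) (by rw [Finset.card_map, h]), by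
    have := F.sel_mem (t.map (Function.Embedding.subtype _)) (by rw [Finset.card_map, h])
    obtain ⟨a, -, ha⟩ := Finset.mem_map.1 this
    rw [← ha]
    exact a.2⟩
  sel_mem t h := by
    have := F.sel_mem (t.map (Function.Embedding.subtype _)) (by rw [Finset.card_map, h])
    obtain ⟨a, hat, ha⟩ := Finset.mem_map.1 this
    convert hat
    exact ha.symm

/-- The bijection `e` is an isomorphism of `T_m`-models: `e (Sel X) = Sel (e X)` for every
`m`-element set `X`. -/
def IsIso (F : Selector m M) (G : Selector m N) (e : M ≃ N) : Prop :=
  ∀ (s : Finset M) (h : s.card = m),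
    e (F.sel s h) = G.sel (s.map e.toEmbedding) ((Finset.card_map _).trans h)

/-- Every nonempty finite model of `T_m` (with domain a finite set of natural numbers) is
isomorphic to infinitely many submodels of `F`. -/
def IsUniversal (F : Selector m ℕ) : Prop :=
  ∀ (M : Finset ℕ), M.Nonempty → ∀ G : Selector m M,
    {s : Finset ℕ | ∃ e : M ≃ s, G.IsIso (F.restrict s) e}.Infinite

/-- Every isomorphism between two finite submodels of `F` extends to an automorphism of `F`. -/
def IsHomogeneous (F : Selector m ℕ) : Prop :=
  ∀ (s t : Finset ℕ) (e : s ≃ t), (F.restrict s).IsIso (F.restrict t) e →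
    ∃ π : Equiv.Perm ℕ, F.IsIso F π ∧ ∀ a : s, π a = e a

/-- The group of automorphisms of `F`, that is, of the permutations `π` of the domain with
`π (Sel X) = Sel (π X)` for every `m`-element set `X`. -/
def autGroup (F : Selector m M) : Subgroup (Equiv.Perm M) where
  carrier := {π | F.IsIso F π}
  one_mem' s h := by
    have hs : s.map (1 : Equiv.Perm M).toEmbedding = s := Finset.map_refl
    simp only [Equiv.Perm.coe_one, id, hs]
  mul_mem' {π ρ} hπ hρ s h := by
    have hs : s.map (π * ρ).toEmbedding = (s.map ρ.toEmbedding).map π.toEmbedding := by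
      rw [Finset.map_map]
      rfl
    simp only [Equiv.Perm.coe_mul, Function.comp, hs]
    rw [hρ s h, hπ]
  inv_mem' {π} hπ s h := by
    have hs : (s.map (π⁻¹ : Equiv.Perm M).toEmbedding).map π.toEmbedding = s := by
      rw [Finset.map_map]
      convert Finset.map_refl
      ext a
      exact π.apply_symm_apply a
    have key := hπ (s.map (π⁻¹ : Equiv.Perm M).toEmbedding) ((Finset.card_map _).trans h)
    simp only [hs] at key
    rw [← key]
    exact π.symm_apply_apply _

end Selector

/-! ### The universe of sets with atoms -/

/-- Well-founded trees with leaves labelled by atoms: codes for sets over the atoms `A`. -/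
inductive PreZFA (A : Type) : Type (u + 1)
  | atom (a : A) : PreZFA A
  | set (ι : Type u) (f : ι → PreZFA A) : PreZFA A

namespace PreZFA

variable {A : Type}

/-- Extensional equality of codes; an atom equals only itself. -/
def Equal : PreZFA.{u} A → PreZFA.{u} A → Prop
  | atom a, atom b => a = b
  | set _ f, set _ g => (∀ i, ∃ j, Equal (f i) (g j)) ∧ ∀ j, ∃ i, Equal (f i) (g j)
  | atom _, set _ _ => False
  | set _ _, atom _ => False

theorem Equal.refl (x : PreZFA.{u} A) : Equal x x := by
  induction x with
  | atom a => simp [Equal]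
  | set ι f ih => exact ⟨fun i => ⟨i, ih i⟩, fun i => ⟨i, ih i⟩⟩

theorem Equal.symm {x y : PreZFA.{u} A} (h : Equal x y) : Equal y x := by
  induction x generalizing y with
  | atom a => cases y <;> simp_all [Equal]
  | set ι f ih =>
    cases y with
    | atom b => simp [Equal] at h
    | set κ g =>
      exact ⟨fun j => (h.2 j).imp fun i hi => ih i hi, fun i => (h.1 i).imp fun j hj => ih i hj⟩

theorem Equal.trans {x y z : PreZFA.{u} A} (h : Equal x y) (h' : Equal y z) : Equal x z := by
  induction x generalizing y z with
  | atom a => cases y <;> cases z <;> simp_all [Equal]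
  | set ι f ih =>
    cases y with
    | atom b => simp [Equal] at h
    | set κ g =>
      cases z with
      | atom c => simp [Equal] at h'
      | set l k =>
        refine ⟨fun i => ?_, fun j => ?_⟩
        · obtain ⟨a, ha⟩ := h.1 i
          obtain ⟨b, hb⟩ := h'.1 a
          exact ⟨b, ih i ha hb⟩
        · obtain ⟨a, ha⟩ := h'.2 j
          obtain ⟨b, hb⟩ := h.2 a
          exact ⟨b, ih b hb ha⟩

instance setoid (A : Type) : Setoid (PreZFA.{u} A) :=
  ⟨Equal, Equal.refl, Equal.symm, Equal.trans⟩

/-- The code `x` names an element of the set named by the second code; atoms have no elements. -/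
def Mem (x : PreZFA.{u} A) : PreZFA.{u} A → Prop
  | atom _ => False
  | set _ f => ∃ i, Equal x (f i)

def IsAtom : PreZFA.{u} A → Prop
  | atom _ => True
  | set _ _ => False

/-- A permutation of the atoms acts on all codes: `π x = {π y : y ∈ x}`. -/
def perm (π : Equiv.Perm A) : PreZFA.{u} A → PreZFA.{u} A
  | atom a => atom (π a)
  | set ι f => set ι fun i => perm π (f i)

theorem Mem.congr {x x' y y' : PreZFA.{u} A} (hx : Equal x x') (hy : Equal y y')
    (h : Mem x y) : Mem x' y' := by
  cases y with
  | atom a => exact h.elim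
  | set ι f =>
    cases y' with
    | atom b => exact hy.elim
    | set κ g =>
      obtain ⟨i, hi⟩ := h
      obtain ⟨j, hj⟩ := hy.1 i
      exact ⟨j, hx.symm.trans (hi.trans hj)⟩

theorem IsAtom.congr {x x' : PreZFA.{u} A} (hx : Equal x x') (h : IsAtom x) : IsAtom x' := by
  cases x <;> cases x' <;> simp_all [Equal, IsAtom]

theorem perm_congr (π : Equiv.Perm A) {x y : PreZFA.{u} A} (h : Equal x y) :
    Equal (perm π x) (perm π y) := by
  induction x generalizing y with
  | atom a => cases y <;> simp_all [Equal, perm]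
  | set ι f ih =>
    cases y with
    | atom b => exact h.elim
    | set κ g =>
      exact ⟨fun i => (h.1 i).imp fun j hj => ih i hj, fun j => (h.2 j).imp fun i hi => ih i hi⟩

end PreZFA

/-- The universe of all sets and atoms over the set `A` of atoms. -/
def ZFA (A : Type) : Type (u + 1) := Quotient (PreZFA.setoid.{u} A)

namespace ZFA

variable {A : Type}

def Mem (x y : ZFA.{u} A) : Prop :=
  Quotient.liftOn₂ x y PreZFA.Mem fun _ _ _ _ h h' =>
    propext ⟨PreZFA.Mem.congr h h', PreZFA.Mem.congr h.symm h'.symm⟩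

def IsAtom (x : ZFA.{u} A) : Prop :=
  Quotient.liftOn x PreZFA.IsAtom fun _ _ h =>
    propext ⟨PreZFA.IsAtom.congr h, PreZFA.IsAtom.congr h.symm⟩

/-- The action of a permutation of the atoms on the universe. -/
def perm (π : Equiv.Perm A) (x : ZFA.{u} A) : ZFA.{u} A :=
  Quotient.map (PreZFA.perm π) (fun _ _ h => PreZFA.perm_congr π h) x

/-- `x` is symmetric with respect to the group `G` and the normal ideal of finite sets of atoms:
some finite set `S` of atoms is a support of `x`, i.e. `fix_G(S) ⊆ sym_G(x)`. -/
def IsSymmetric (G : Subgroup (Equiv.Perm A)) (x : ZFA.{u} A) : Prop :=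
  ∃ S : Finset A, ∀ π ∈ G, (∀ a ∈ S, π a = a) → perm π x = x

/-- `x` is hereditarily symmetric. -/
inductive IsHereditarilySymmetric (G : Subgroup (Equiv.Perm A)) : ZFA.{u} A → Prop
  | intro (x : ZFA.{u} A) (symm : IsSymmetric G x)
      (mem : ∀ y, Mem y x → IsHereditarilySymmetric G y) : IsHereditarilySymmetric G x

end ZFA

/-! ### Set theory with atoms inside a structure -/

/-- A structure for the language of set theory with atoms. -/
class SetAtomStructure (M : Type*) extends Membership M M where
  IsAtom : M → Prop

/-- The permutation model given by the group `G` of permutations of the atoms and the normal ideal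
of finite sets of atoms: the class of all hereditarily symmetric objects. -/
def PermutationModel {A : Type} (G : Subgroup (Equiv.Perm A)) : Type (u + 1) :=
  {x : ZFA.{u} A // ZFA.IsHereditarilySymmetric G x}

instance {A : Type} (G : Subgroup (Equiv.Perm A)) :
    SetAtomStructure (PermutationModel.{u} G) where
  mem y x := ZFA.Mem x.1 y.1
  IsAtom x := ZFA.IsAtom x.1

/-! All quantifiers below range over the structure `M`, so these are the relativizations to `M` of
the usual notions. -/
namespace SetAtomStructure

variable {M : Type*} [SetAtomStructure M]

def IsSet (x : M) : Prop := ¬ IsAtom x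

/-- `y` is a subset of `x`. -/
def IsSubset (y x : M) : Prop := IsSet y ∧ ∀ z, z ∈ y → z ∈ x

/-- `p = {a, b}`. -/
def IsPair (p a b : M) : Prop := IsSet p ∧ ∀ z, z ∈ p ↔ z = a ∨ z = b

/-- `p = (a, b) = {{a}, {a, b}}`. -/
def IsOrderedPair (p a b : M) : Prop := ∃ s t, IsPair s a a ∧ IsPair t a b ∧ IsPair p s t

/-- `(a, b) ∈ f`. -/
def Maps (f a b : M) : Prop := ∃ p, p ∈ f ∧ IsOrderedPair p a b

/-- `f` is a function with domain `D`. -/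
def IsFunctionOn (f D : M) : Prop :=
  IsSet f ∧ (∀ p, p ∈ f → ∃ a b, a ∈ D ∧ IsOrderedPair p a b) ∧ ∀ a, a ∈ D → ∃! b, Maps f a b

/-- `f` is a bijection from `D` onto `X`. -/
def IsBijection (f D X : M) : Prop :=
  IsFunctionOn f D ∧ (∀ a b, Maps f a b → b ∈ X) ∧ ∀ b, b ∈ X → ∃! a, Maps f a b

def IsTransitiveSet (x : M) : Prop := IsSet x ∧ ∀ y, y ∈ x → ∀ z, z ∈ y → z ∈ x

/-- `x = ∅` or `x = k ∪ {k}` for some `k` (for sets `x`). -/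
def IsZeroOrSucc (x : M) : Prop := (∀ y, y ∉ x) ∨ ∃ k, ∀ y, y ∈ x ↔ y ∈ k ∨ y = k

/-- `n` is a von Neumann natural number: an ordinal (a transitive set of transitive sets) such that
`n` and all its elements are zero or successors. -/
def IsNatural (n : M) : Prop :=
  IsTransitiveSet n ∧ (∀ k, k ∈ n → IsTransitiveSet k) ∧
    IsZeroOrSucc n ∧ ∀ k, k ∈ n → IsZeroOrSucc k

/-- `X` is a finite set: there is a bijection from a natural number onto `X`. -/
def IsFinite (X : M) : Prop := IsSet X ∧ ∃ n f, IsNatural n ∧ IsBijection f n X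

def IsInfinite (X : M) : Prop := IsSet X ∧ ¬ IsFinite X

/-- `z` is a set with exactly `m` elements. -/
def HasCard (m : ℕ) (z : M) : Prop :=
  IsSet z ∧ ∃ x : Fin m → M, Function.Injective x ∧ ∀ y, y ∈ z ↔ ∃ i, y = x i

/-- `D = [Y]^m`, the set of all `m`-element subsets of `Y`. -/
def IsSubsetsOfCard (m : ℕ) (D Y : M) : Prop :=
  IsSet D ∧ ∀ z, z ∈ D ↔ IsSubset z Y ∧ HasCard m z

/-- `f` is a choice function on the family `D`. -/
def IsChoiceFunction (f D : M) : Prop := IsFunctionOn f D ∧ ∀ z v, Maps f z v → v ∈ z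

/-- The structure `M` satisfies `RC_m`: every infinite set `X` has an infinite subset `Y` such
that `[Y]^m` has a choice function. -/
def SatisfiesRC (m : ℕ) (M : Type*) [SetAtomStructure M] : Prop :=
  ∀ X : M, IsInfinite X → ∃ Y : M, IsSubset Y X ∧ IsInfinite Y ∧
    ∃ D f : M, IsSubsetsOfCard m D Y ∧ IsChoiceFunction f D

end SetAtomStructure

/-!
The models `F` of the statement are those with the one-point extension property: every one-point
extension of a finite submodel is realized in `F`. Such a model exists on `ω`, and back-and-forth
turns the extension property into universality and homogeneity, and conversely.

Let `X` be an infinite set of the permutation model, with support `S`. If `S` supports every element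
of `X`, then a choice function of the outer universe on the `m`-element subsets of `X` lies in the
model. Otherwise some `x ∈ X` has a finite `E ⊇ S` and an atom `a` such that `E ∪ {a}` supports `x`
but `E` does not. By amalgamation `a` can be recovered from `x` over `E`, so that the orbit of `x`
under the pointwise stabilizer of `E` is in equivariant bijection with the infinite orbit of `a`,
from which it inherits the selector.
-/

section Supports

open MulAction

variable {G A Z : Type*} [Group G] [MulAction G A] [MulAction G Z] {E : Set A} {a : A} {x : Z}

theorem smul_eq_smul_of_supports_insert (hx : Supports G (insert a E) x) {g h : G}
    (hg : g ∈ fixingSubgroup G E) (hh : h ∈ fixingSubgroup G E) (hgh : g • a = h • a) :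
    g • x = h • x := by
  rw [← inv_smul_eq_iff, smul_smul]
  refine hx _ (Set.forall_mem_insert.2 ⟨?_, ?_⟩)
  · rw [mul_smul, hgh, inv_smul_smul]
  · exact (mem_fixingSubgroup_iff _).1 (mul_mem (inv_mem hh) hg)

theorem exists_supports_insert {S T : Finset A} (hT : Supports G (T : Set A) x)
    (hS : ¬ Supports G (S : Set A) x) :
    ∃ (E : Finset A) (a : A), S ⊆ E ∧ Supports G (insert a (E : Set A)) x ∧
      ¬ Supports G (E : Set A) x := by
  classical
  have hTS : Supports G ((T ∪ S : Finset A) : Set A) x :=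
    hT.mono (Finset.coe_subset.2 Finset.subset_union_left)
  clear hT
  induction T using Finset.induction_on with
  | empty => exact absurd (by rwa [Finset.empty_union] at hTS) hS
  | insert a T _ ih =>
    by_cases h : Supports G ((T ∪ S : Finset A) : Set A) x
    · exact ih h
    · rw [Finset.insert_union, Finset.coe_insert] at hTS
      exact ⟨T ∪ S, a, Finset.subset_union_right, hTS, h⟩

end Supports

namespace Selector

/-! ### Selections as a relation -/

section Picks

variable {m : ℕ} {A B : Type*} {F : Selector m A} {G : Selector m B} {s t : Finset A} {a b : A}

/-- `F` selects `a` from the `m`-element set `s`. The relation is false when `s.card ≠ m`, so that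
it can be stated without a proof of `s.card = m`. -/
def Picks (F : Selector m A) (s : Finset A) (a : A) : Prop :=
  ∃ h : s.card = m, F.sel s h = a

theorem Picks.card (h : F.Picks s a) : s.card = m := h.1

theorem Picks.mem (h : F.Picks s a) : a ∈ s := by
  obtain ⟨h, rfl⟩ := h
  exact F.sel_mem s h

theorem Picks.unique (h : F.Picks s a) (h' : F.Picks s b) : a = b := by
  obtain ⟨h, rfl⟩ := h
  obtain ⟨h', rfl⟩ := h'
  rfl

theorem exists_picks (F : Selector m A) (h : s.card = m) : ∃ a, F.Picks s a :=
  ⟨_, h, rfl⟩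

theorem pos (F : Selector m A) : 0 < m := by
  rw [Nat.pos_iff_ne_zero]
  rintro rfl
  exact Finset.notMem_empty _ (F.sel_mem ∅ Finset.card_empty)

theorem picks_insert_self_iff [DecidableEq A] (ha : a ∉ t) (ht : t.card + 1 = m) :
    F.Picks (insert a t) a ↔ ∀ b ∈ t, ¬ F.Picks (insert a t) b := by
  refine ⟨fun h b hb hb' => ha (h.unique hb' ▸ hb), fun h => ?_⟩
  obtain ⟨b, hb⟩ := F.exists_picks ((Finset.card_insert_of_notMem ha).trans ht)
  rcases Finset.mem_insert.1 hb.mem with rfl | hbt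
  · exact hb
  · exact absurd hb (h b hbt)

theorem isIso_of_picks {e : A ≃ B}
    (h : ∀ s a, F.Picks s a → G.Picks (s.map e.toEmbedding) (e a)) : F.IsIso G e := fun s hs =>
  (h s _ ⟨hs, rfl⟩).2.symm

theorem IsIso.picks_map_iff {e : A ≃ B} (he : F.IsIso G e) :
    G.Picks (s.map e.toEmbedding) (e a) ↔ F.Picks s a := by
  constructor
  · rintro ⟨h, h'⟩
    have hs : s.card = m := (Finset.card_map _).symm.trans h
    exact ⟨hs, e.injective ((he s hs).trans h')⟩
  · rintro ⟨h, rfl⟩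
    exact ⟨(Finset.card_map _).trans h, (he s h).symm⟩

theorem restrict_picks_iff {t : Finset s} {a : s} :
    (F.restrict s).Picks t a ↔ F.Picks (t.map (Function.Embedding.subtype _)) a := by
  constructor
  · rintro ⟨h, rfl⟩
    exact ⟨(Finset.card_map _).trans h, rfl⟩
  · rintro ⟨h, h'⟩
    exact ⟨(Finset.card_map _).symm.trans h, Subtype.ext h'⟩

theorem exists_forall_picks (hm : 0 < m) (P : Finset A → A → Prop) :
    ∃ F : Selector m A, ∀ s a, F.Picks s a → (∃ b ∈ s, P s b) → P s a := by
  have key : ∀ s : Finset A, s.card = m → ∃ a ∈ s, (∃ b ∈ s, P s b) → P s a := by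
    intro s hs
    by_cases h : ∃ b ∈ s, P s b
    · obtain ⟨b, hb, hP⟩ := h
      exact ⟨b, hb, fun _ => hP⟩
    · obtain ⟨a, ha⟩ := Finset.card_pos.1 (hs ▸ hm)
      exact ⟨a, ha, fun h' => absurd h' h⟩
  choose f hf hP using key
  refine ⟨⟨f, hf⟩, ?_⟩
  rintro s _ ⟨hs, rfl⟩
  exact hP s hs

theorem exists_restrict_eq {M : Finset A} (G : Selector m M) :
    ∃ F : Selector m A, F.restrict M = G := by
  obtain ⟨F, hF⟩ := exists_forall_picks G.pos fun (s : Finset A) a =>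
    ∃ (t : Finset M) (b : M), t.map (Function.Embedding.subtype _) = s ∧ b.1 = a ∧ G.Picks t b
  have hsel : (F.restrict M).sel = G.sel := by
    funext t ht
    obtain ⟨t', b, htt', hb, hp⟩ := hF (t.map (Function.Embedding.subtype _)) _
      ⟨(Finset.card_map _).trans ht, rfl⟩
      ⟨G.sel t ht, Finset.mem_map_of_mem _ (G.sel_mem t ht), t, _, rfl, rfl, ht, rfl⟩
    obtain rfl := Finset.map_injective _ htt'
    exact (Subtype.ext hb).symm.trans hp.2.symm
  refine ⟨F, ?_⟩
  cases G
  cases h : F.restrict M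
  simp_all only

end Picks

/-! ### Types of points over finite sets and the extension property -/

section Types

variable {m : ℕ} {A : Type*} [DecidableEq A] {F : Selector m A} {n a : A} {s t : Finset A}
  {R : Finset A → A → Prop}

/-- The point `n` realizes the type `R` over `s`: among the `m`-element sets `insert n t` with
`t ⊆ s`, an element `b` of `t` is selected if and only if `R t b`. If no such `b` exists, then `n`
itself is selected. -/
def Realizes (F : Selector m A) (n : A) (s : Finset A) (R : Finset A → A → Prop) : Prop :=
  ∀ t ⊆ s, t.card + 1 = m → ∀ b ∈ t, F.Picks (insert n t) b ↔ R t b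

/-- The relation `R` describes a possible type over `s`: it selects at most one element of each
`t ⊆ s`. -/
def IsConsistent (s : Finset A) (R : Finset A → A → Prop) : Prop :=
  ∀ t ⊆ s, ∀ b ∈ t, ∀ c ∈ t, R t b → R t c → b = c

/-- The type of the point `n` in the model `F`. -/
def typeOf (F : Selector m A) (n : A) (t : Finset A) (b : A) : Prop := F.Picks (insert n t) b

/-- The extension property: every one-point extension of a finite submodel is realized. -/
def HasExtension (F : Selector m A) : Prop :=
  ∀ (s : Finset A) (R : Finset A → A → Prop), IsConsistent s R → ∃ n ∉ s, F.Realizes n s R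

theorem isConsistent_typeOf (F : Selector m A) (n : A) (s : Finset A) :
    IsConsistent s (F.typeOf n) := fun _ _ _ _ _ _ h h' => h.unique h'

theorem HasExtension.avoiding (hF : F.HasExtension) (v : Finset A) (hR : IsConsistent s R) :
    ∃ n ∉ s, n ∉ v ∧ F.Realizes n s R := by
  have hR' : IsConsistent (s ∪ v) fun t b => t ⊆ s ∧ R t b :=
    fun t _ b hb c hc h h' => hR t h.1 b hb c hc h.2 h'.2
  obtain ⟨n, hn, h⟩ := hF _ _ hR'
  rw [Finset.notMem_union] at hn
  refine ⟨n, hn.1, hn.2, fun t ht hm b hb => ?_⟩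
  rw [h t (ht.trans Finset.subset_union_left) hm b hb]
  exact and_iff_right ht

/-- The element of `insert n t` that a point `n` of type `R` makes the model select: the one singled
out by `R t`, or `n` itself if there is none. -/
def IsDesignated (n : A) (R : Finset A → A → Prop) (t : Finset A) (a : A) : Prop :=
  a ∈ t ∧ R t a ∨ a = n ∧ ∀ b ∈ t, ¬ R t b

theorem exists_isDesignated (n : A) (R : Finset A → A → Prop) (t : Finset A) :
    ∃ a ∈ insert n t, IsDesignated n R t a := by
  by_cases h : ∃ b ∈ t, R t b
  · obtain ⟨b, hb, hR⟩ := h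
    exact ⟨b, Finset.mem_insert_of_mem hb, .inl ⟨hb, hR⟩⟩
  · push Not at h
    exact ⟨n, Finset.mem_insert_self _ _, .inr ⟨rfl, h⟩⟩

theorem IsConsistent.realizes (hR : IsConsistent s R) (hn : n ∉ s)
    (h : ∀ t ⊆ s, ∀ a, F.Picks (insert n t) a → IsDesignated n R t a) : F.Realizes n s R := by
  intro t ht hm b hb
  have hnt : n ∉ t := fun h => hn (ht h)
  constructor
  · intro hp
    rcases h t ht b hp with ⟨-, hR⟩ | ⟨rfl, -⟩
    · exact hR
    · exact absurd hb hnt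
  · intro hRb
    obtain ⟨a, ha⟩ := F.exists_picks ((Finset.card_insert_of_notMem hnt).trans hm)
    rcases h t ht a ha with ⟨hat, hRa⟩ | ⟨-, hnone⟩
    · exact hR t ht b hb a hat hRb hRa ▸ ha
    · exact absurd hRb (hnone b hb)

theorem exists_realizes (F : Selector m A) (hR : IsConsistent s R) (hn : n ∉ s) :
    ∃ G : Selector m A, (∀ t ⊆ s, ∀ a, G.Picks t a → F.Picks t a) ∧ G.Realizes n s R := by
  obtain ⟨G, hG⟩ := exists_forall_picks F.pos fun t a =>
    if n ∈ t then IsDesignated n R (t.erase n) a else F.Picks t a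
  refine ⟨G, fun t ht a ha => ?_, hR.realizes hn fun t ht a ha => ?_⟩
  · have hnt : n ∉ t := fun h => hn (ht h)
    obtain ⟨b, hb⟩ := F.exists_picks ha.card
    simpa only [if_neg hnt] using hG t a ha ⟨b, hb.mem, by rwa [if_neg hnt]⟩
  · have hnt : n ∉ t := fun h => hn (ht h)
    have := hG (insert n t) a ha
    simp only [Finset.mem_insert_self, if_true, Finset.erase_insert hnt] at this
    exact this (exists_isDesignated n R t)

theorem exists_hasExtension (hm : 0 < m) : ∃ F : Selector m ℕ, F.HasExtension := by
  obtain ⟨f, hf⟩ := exists_surjective_nat (Finset (Finset ℕ × ℕ))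
  -- `n` prescribes, through the second component of `Nat.unpair n`, the selections from the sets
  -- with largest element `n`; each finite set of prescriptions is used by arbitrarily large `n`.
  obtain ⟨F, hF⟩ := exists_forall_picks hm fun (u : Finset ℕ) a =>
    ∃ n ∈ u, (∀ b ∈ u, b ≤ n) ∧
      IsDesignated n (fun t b => (t, b) ∈ f (Nat.unpair n).2) (u.erase n) a
  classical
  refine ⟨F, fun s R hR => ?_⟩
  obtain ⟨i, hi⟩ := hf ((s.powerset ×ˢ s).filter fun p => R p.1 p.2)
  let n := Nat.pair (s.sup id + 1) i
  have hlt : ∀ a ∈ s, a < n := fun a ha =>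
    (Nat.lt_succ_of_le (Finset.le_sup (f := id) ha)).trans_le (Nat.left_le_pair _ _)
  have hns : n ∉ s := fun h => lt_irrefl _ (hlt n h)
  refine ⟨n, hns, hR.realizes hns fun t ht a ha => ?_⟩
  have hnt : n ∉ t := fun h => hns (ht h)
  have hle : ∀ b ∈ insert n t, b ≤ n :=
    Finset.forall_mem_insert .. |>.2 ⟨le_rfl, fun b hb => (hlt b (ht hb)).le⟩
  have hR_iff : ∀ b ∈ t, (t, b) ∈ f i ↔ R t b := fun b hb => by
    simp only [hi, Finset.mem_filter, Finset.mem_product, Finset.mem_powerset, ht, ht hb, and_self,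
      true_and]
  have hdes : ∀ b, IsDesignated n (fun t b => (t, b) ∈ f i) t b ↔ IsDesignated n R t b := fun b =>
    or_congr (and_congr_right (hR_iff b))
      (and_congr_right fun _ => forall₂_congr fun c hc => not_congr (hR_iff c hc))
  obtain ⟨b, hb, hbR⟩ := exists_isDesignated n R t
  obtain ⟨k, hk, hkle, hka⟩ := hF (insert n t) a ha
    ⟨b, hb, n, Finset.mem_insert_self _ _, hle, by
      rwa [Finset.erase_insert hnt, Nat.unpair_pair, hdes]⟩
  obtain rfl : k = n := le_antisymm (hle k hk) (hkle n (Finset.mem_insert_self _ _))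
  rwa [Finset.erase_insert hnt, Nat.unpair_pair, hdes] at hka

end Types

/-! ### Partial isomorphisms and back-and-forth -/

section PartialIso

variable {m : ℕ} {A B : Type*} [DecidableEq A] [DecidableEq B] {F : Selector m A}
  {G : Selector m B} {r r' : Set (A × B)} {a : A} {b : B}

/-- The relation `r` is the graph of an isomorphism between the submodels of `F` and `G` on its
domain and range. -/
structure IsPartialIso (F : Selector m A) (G : Selector m B) (r : Set (A × B)) : Prop where
  injOn_fst : r.InjOn Prod.fst
  injOn_snd : r.InjOn Prod.snd
  picks_iff : ∀ t : Finset (A × B), (t : Set (A × B)) ⊆ r → t.card = m → ∀ p ∈ t,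
    (F.Picks (t.image Prod.fst) p.1 ↔ G.Picks (t.image Prod.snd) p.2)

namespace IsPartialIso

theorem empty (F : Selector m A) (G : Selector m B) : IsPartialIso F G ∅ where
  injOn_fst := Set.injOn_empty _
  injOn_snd := Set.injOn_empty _
  picks_iff _ ht _ _ hp := (ht hp).elim

theorem mono (h : IsPartialIso F G r) (hr : r' ⊆ r) : IsPartialIso F G r' where
  injOn_fst := h.injOn_fst.mono hr
  injOn_snd := h.injOn_snd.mono hr
  picks_iff t ht := h.picks_iff t (ht.trans hr)

theorem swap (h : IsPartialIso F G r) : IsPartialIso G F (Prod.swap ⁻¹' r) where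
  injOn_fst _ hp _ hq hpq := Prod.swap_injective (h.injOn_snd hp hq hpq)
  injOn_snd _ hp _ hq hpq := Prod.swap_injective (h.injOn_fst hp hq hpq)
  picks_iff t ht hm p hp := by
    have hsub : ((t.image Prod.swap : Finset (A × B)) : Set (A × B)) ⊆ r := by
      rw [Finset.coe_image, Set.image_subset_iff]
      exact ht
    have := h.picks_iff _ hsub ((Finset.card_image_of_injective _ Prod.swap_injective).trans hm)
      p.swap (Finset.mem_image_of_mem _ hp)
    simp only [Finset.image_image, Prod.fst_swap, Prod.snd_swap] at this
    exact this.symm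

theorem of_finite (h : ∀ u : Finset (A × B), (u : Set (A × B)) ⊆ r → IsPartialIso F G u) :
    IsPartialIso F G r where
  injOn_fst p hp q hq :=
    (h {p, q} (by simp [Set.insert_subset_iff, hp, hq])).injOn_fst (by simp) (by simp)
  injOn_snd p hp q hq :=
    (h {p, q} (by simp [Set.insert_subset_iff, hp, hq])).injOn_snd (by simp) (by simp)
  picks_iff t ht := (h t ht).picks_iff t subset_rfl

theorem insert_pair (hr : IsPartialIso F G r) (ha : a ∉ Prod.fst '' r) (hb : b ∉ Prod.snd '' r)
    (h : ∀ u : Finset (A × B), (u : Set (A × B)) ⊆ r → u.card + 1 = m → ∀ p ∈ u,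
      (F.Picks (insert a (u.image Prod.fst)) p.1 ↔ G.Picks (insert b (u.image Prod.snd)) p.2)) :
    IsPartialIso F G (insert (a, b) r) := by
  have hab : (a, b) ∉ r := fun h => ha ⟨_, h, rfl⟩
  refine ⟨(Set.injOn_insert hab).2 ⟨hr.injOn_fst, ha⟩,
    (Set.injOn_insert hab).2 ⟨hr.injOn_snd, hb⟩, fun t ht hm p hp => ?_⟩
  by_cases habt : (a, b) ∈ t
  · obtain ⟨u, hu, rfl⟩ : ∃ u, (a, b) ∉ u ∧ insert (a, b) u = t :=
      ⟨t.erase (a, b), Finset.notMem_erase _ _, Finset.insert_erase habt⟩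
    rw [Finset.coe_insert, Set.insert_subset_insert_iff (by exact_mod_cast hu)] at ht
    rw [Finset.card_insert_of_notMem hu] at hm
    have hau : a ∉ u.image Prod.fst := fun h' => ha (Set.image_mono ht (by exact_mod_cast h'))
    have hbu : b ∉ u.image Prod.snd := fun h' => hb (Set.image_mono ht (by exact_mod_cast h'))
    have cfst : (u.image Prod.fst).card + 1 = m := by
      rw [Finset.card_image_of_injOn (hr.injOn_fst.mono ht), hm]
    have csnd : (u.image Prod.snd).card + 1 = m := by
      rw [Finset.card_image_of_injOn (hr.injOn_snd.mono ht), hm]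
    rw [Finset.image_insert, Finset.image_insert]
    rcases Finset.mem_insert.1 hp with rfl | hp
    · rw [picks_insert_self_iff hau cfst, picks_insert_self_iff hbu csnd, Finset.forall_mem_image,
        Finset.forall_mem_image]
      exact forall₂_congr fun q hq => not_congr (h u ht hm q hq)
    · exact h u ht hm p hp
  · exact hr.picks_iff t ((Set.subset_insert_iff_of_notMem (by exact_mod_cast habt)).1 ht) hm p hp

theorem extend_right (hr : IsPartialIso F G r) (hfin : r.Finite) (hG : G.HasExtension)
    (v : Finset B) (ha : a ∉ Prod.fst '' r) :
    ∃ b ∉ v, IsPartialIso F G (insert (a, b) r) := by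
  -- `R` is the type of `a`, transported along `r`.
  let R : Finset B → B → Prop := fun t b => ∃ u : Finset (A × B), (u : Set (A × B)) ⊆ r ∧
    u.image Prod.snd = t ∧ ∃ p ∈ u, p.2 = b ∧ F.Picks (insert a (u.image Prod.fst)) p.1
  have heq : ∀ {u u' : Finset (A × B)}, (u : Set (A × B)) ⊆ r → (u' : Set (A × B)) ⊆ r →
      u'.image Prod.snd = u.image Prod.snd → u' = u := fun hu hu' h => by
    rwa [← Finset.coe_inj, Finset.coe_image, Finset.coe_image,
      hr.injOn_snd.image_eq_image_iff hu' hu, Finset.coe_inj] at h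
  have hR : IsConsistent (hfin.toFinset.image Prod.snd) R := by
    rintro _ - _ - _ - ⟨u, hu, rfl, p, hp, rfl, hpF⟩ ⟨u', hu', h, q, hq, rfl, hqF⟩
    obtain rfl := heq hu hu' h
    rw [hr.injOn_fst (hu hp) (hu hq) (hpF.unique hqF)]
  obtain ⟨b, hb, hbv, hbR⟩ := hG.avoiding v hR
  refine ⟨b, hbv, hr.insert_pair ha ?_ fun u hu hm p hp => ?_⟩
  · rwa [← Finset.mem_coe, Finset.coe_image, hfin.coe_toFinset] at hb
  · have hus : u.image Prod.snd ⊆ hfin.toFinset.image Prod.snd :=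
      Finset.image_subset_image fun q hq => hfin.mem_toFinset.2 (hu hq)
    rw [hbR _ hus (by rw [Finset.card_image_of_injOn (hr.injOn_snd.mono hu), hm]) p.2
      (Finset.mem_image_of_mem _ hp)]
    constructor
    · exact fun h => ⟨u, hu, rfl, p, hp, rfl, h⟩
    · rintro ⟨u', hu', h, q, hq, hqp, hqF⟩
      obtain rfl := heq hu hu' h
      rwa [← hr.injOn_snd (hu hq) (hu hp) hqp]

theorem exists_right (hr : IsPartialIso F G r) (hfin : r.Finite) (hG : G.HasExtension) (a : A) :
    ∃ r' ⊇ r, r'.Finite ∧ IsPartialIso F G r' ∧ a ∈ Prod.fst '' r' := by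
  by_cases ha : a ∈ Prod.fst '' r
  · exact ⟨r, subset_rfl, hfin, hr, ha⟩
  · obtain ⟨b, -, hab⟩ := hr.extend_right hfin hG ∅ ha
    exact ⟨_, Set.subset_insert _ _, hfin.insert _, hab, (a, b), Set.mem_insert _ _, rfl⟩

theorem exists_left (hr : IsPartialIso F G r) (hfin : r.Finite) (hF : F.HasExtension) (b : B) :
    ∃ r' ⊇ r, r'.Finite ∧ IsPartialIso F G r' ∧ b ∈ Prod.snd '' r' := by
  obtain ⟨r', hrr', hfin', hr', ⟨b', a⟩, hba, rfl⟩ :=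
    hr.swap.exists_right (hfin.preimage Prod.swap_injective.injOn) hF b
  exact ⟨Prod.swap ⁻¹' r', fun p hp => hrr' hp, hfin'.preimage Prod.swap_injective.injOn,
    hr'.swap, (a, b'), hba, rfl⟩

theorem picks_image_iff (hr : IsPartialIso F G r) {φ : A → B} {t : Finset A}
    (hφ : ∀ c ∈ t, (c, φ c) ∈ r) (hm : t.card = m) (ha : a ∈ t) :
    F.Picks t a ↔ G.Picks (t.image φ) (φ a) := by
  have hinj : Function.Injective fun c => (c, φ c) := fun _ _ h => (Prod.ext_iff.1 h).1
  have hsub : ((t.image fun c => (c, φ c) : Finset (A × B)) : Set (A × B)) ⊆ r := by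
    rw [Finset.coe_image, Set.image_subset_iff]
    exact hφ
  have := hr.picks_iff _ hsub ((Finset.card_image_of_injective _ hinj).trans hm) (a, φ a)
    (Finset.mem_image_of_mem _ ha)
  simpa only [Finset.image_image, Function.comp_def, Finset.image_id'] using this

theorem congr_left {F' : Selector m A} (hr : IsPartialIso F G r)
    (h : ∀ t : Finset A, (t : Set A) ⊆ Prod.fst '' r → ∀ a, F.Picks t a → F'.Picks t a) :
    IsPartialIso F' G r where
  injOn_fst := hr.injOn_fst
  injOn_snd := hr.injOn_snd
  picks_iff t ht hm p hp := by
    have hsub : ((t.image Prod.fst : Finset A) : Set A) ⊆ Prod.fst '' r := by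
      rw [Finset.coe_image]
      exact Set.image_mono ht
    rw [← hr.picks_iff t ht hm p hp]
    refine ⟨fun h' => ?_, h _ hsub _⟩
    obtain ⟨b, hb⟩ := F.exists_picks h'.card
    rwa [h'.unique (h _ hsub _ hb)]

theorem exists_isIso (hr : IsPartialIso F G r) (hfst : Prod.fst '' r = Set.univ)
    (hsnd : Prod.snd '' r = Set.univ) : ∃ e : A ≃ B, F.IsIso G e ∧ ∀ p ∈ r, e p.1 = p.2 := by
  let efst : r ≃ A := Equiv.ofBijective (fun p => p.1.1) ⟨hr.injOn_fst.injective, fun a => by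
    obtain ⟨p, hp, rfl⟩ := hfst.superset (Set.mem_univ a)
    exact ⟨⟨p, hp⟩, rfl⟩⟩
  let esnd : r ≃ B := Equiv.ofBijective (fun p => p.1.2) ⟨hr.injOn_snd.injective, fun b => by
    obtain ⟨p, hp, rfl⟩ := hsnd.superset (Set.mem_univ b)
    exact ⟨⟨p, hp⟩, rfl⟩⟩
  let e : A ≃ B := efst.symm.trans esnd
  have he : ∀ p ∈ r, e p.1 = p.2 := fun p hp => by
    have : efst.symm p.1 = ⟨p, hp⟩ := efst.symm_apply_eq.2 rfl
    exact congrArg esnd this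
  refine ⟨e, isIso_of_picks fun s a h => ?_, he⟩
  have hmem : ∀ c, (c, e c) ∈ r := fun c => by
    obtain ⟨p, hp, rfl⟩ := hfst.superset (Set.mem_univ c)
    rwa [he p hp]
  rw [Finset.map_eq_image]
  exact (hr.picks_image_iff (fun c _ => hmem c) h.card h.mem).1 h

end IsPartialIso

theorem IsIso.isPartialIso {e : A ≃ B} (he : F.IsIso G e) :
    IsPartialIso F G {p | e p.1 = p.2} where
  injOn_fst p hp q hq h := Prod.ext h (hp.symm.trans ((congrArg e h).trans hq))
  injOn_snd p hp q hq h := Prod.ext (e.injective (hp.trans (h.trans hq.symm))) h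
  picks_iff t ht _ p hp := by
    have himage : t.image Prod.snd = (t.image Prod.fst).map e.toEmbedding := by
      rw [Finset.map_eq_image, Finset.image_image]
      exact Finset.image_congr fun q hq => (ht hq).symm
    rw [himage, ← ht hp, he.picks_map_iff]

theorem isPartialIso_restrict_iff {s : Finset A} {t : Finset B} {r : Set (s × t)} :
    IsPartialIso (F.restrict s) (G.restrict t) r ↔
      IsPartialIso F G (Prod.map Subtype.val Subtype.val '' r) := by
  let i : s × t ↪ A × B := (Function.Embedding.subtype _).prodMap (Function.Embedding.subtype _)
  have hpicks : ∀ u : Finset (s × t), ∀ p : s × t,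
      ((F.restrict s).Picks (u.image Prod.fst) p.1 ↔ (G.restrict t).Picks (u.image Prod.snd) p.2) ↔
      (F.Picks ((u.map i).image Prod.fst) (i p).1 ↔
        G.Picks ((u.map i).image Prod.snd) (i p).2) := fun u p => by
    simp only [restrict_picks_iff, Finset.map_eq_image, Finset.image_image]
    rfl
  constructor
  · refine fun h => ⟨?_, ?_, fun u hu hm => ?_⟩
    · rintro _ ⟨p, hp, rfl⟩ _ ⟨q, hq, rfl⟩ hpq
      rw [h.injOn_fst hp hq (Subtype.ext hpq)]
    · rintro _ ⟨p, hp, rfl⟩ _ ⟨q, hq, rfl⟩ hpq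
      rw [h.injOn_snd hp hq (Subtype.ext hpq)]
    · obtain ⟨v, hv, rfl⟩ : ∃ v : Finset (s × t), (v : Set (s × t)) ⊆ r ∧ v.map i = u := by
        obtain ⟨v, hv, rfl⟩ := Finset.subset_set_image_iff.1 hu
        exact ⟨v, hv, Finset.map_eq_image _ _⟩
      rw [Finset.card_map] at hm
      exact Finset.forall_mem_map.2 fun p hp => (hpicks v p).1 (h.picks_iff v hv hm p hp)
  · refine fun h => ⟨fun p hp q hq hpq => ?_, fun p hp q hq hpq => ?_, fun v hv hm p hp => ?_⟩
    · exact i.injective (h.injOn_fst ⟨p, hp, rfl⟩ ⟨q, hq, rfl⟩ (congrArg Subtype.val hpq))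
    · exact i.injective (h.injOn_snd ⟨p, hp, rfl⟩ ⟨q, hq, rfl⟩ (congrArg Subtype.val hpq))
    · refine (hpicks v p).2 (h.picks_iff _ ?_ ((Finset.card_map _).trans hm) _
        (Finset.mem_map_of_mem _ hp))
      rw [Finset.coe_map]
      exact Set.image_mono hv

open Order in
theorem HasExtension.exists_isIso_extending [Countable A] [Countable B] (hF : F.HasExtension)
    (hG : G.HasExtension) (hr : IsPartialIso F G r) (hfin : r.Finite) :
    ∃ e : A ≃ B, F.IsIso G e ∧ ∀ p ∈ r, e p.1 = p.2 := by
  let P := {r : Set (A × B) // r.Finite ∧ IsPartialIso F G r}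
  let D : A ⊕ B → Cofinal P := Sum.elim
    (fun a => ⟨{p | a ∈ Prod.fst '' p.1}, fun p =>
      let ⟨r', hle, hfin, hr', ha⟩ := p.2.2.exists_right p.2.1 hG a
      ⟨⟨r', hfin, hr'⟩, ha, hle⟩⟩)
    (fun b => ⟨{p | b ∈ Prod.snd '' p.1}, fun p =>
      let ⟨r', hle, hfin, hr', hb⟩ := p.2.2.exists_left p.2.1 hF b
      ⟨⟨r', hfin, hr'⟩, hb, hle⟩⟩)
  have := Encodable.ofCountable (A ⊕ B)
  let I := idealOfCofinals (⟨r, hfin, hr⟩ : P) D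
  have hD : ∀ x, ∃ p ∈ D x, p ∈ I := cofinal_meets_idealOfCofinals _ D
  let U : Set (A × B) := ⋃ p ∈ I, p.1
  have hU : ∀ {p}, p ∈ I → p.1 ⊆ U := fun hp => Set.subset_biUnion_of_mem hp
  have hUiso : IsPartialIso F G U := IsPartialIso.of_finite fun u hu => by
    obtain ⟨p, -, hup⟩ := DirectedOn.exists_mem_subset_of_finset_subset_biUnion
      ⟨_, mem_idealOfCofinals _ _⟩ I.directed hu
    exact p.2.2.mono hup
  obtain ⟨e, he, hep⟩ := hUiso.exists_isIso
    (Set.eq_univ_of_forall fun a =>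
      let ⟨p, hpa, hp⟩ := hD (.inl a)
      Set.image_mono (hU hp) hpa)
    (Set.eq_univ_of_forall fun b =>
      let ⟨p, hpb, hp⟩ := hD (.inr b)
      Set.image_mono (hU hp) hpb)
  exact ⟨e, he, fun p hp => hep p (hU (mem_idealOfCofinals _ _) hp)⟩

end PartialIso

/-! ### The extension property characterizes universal homogeneous selectors -/

section Fraisse

variable {m : ℕ}

theorem IsPartialIso.exists_restrict_isIso {A B : Type*} [DecidableEq A] [DecidableEq B]
    {F : Selector m A} {G : Selector m B} {r : Set (A × B)} {s : Finset A} {t : Finset B}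
    (hr : IsPartialIso F G r) (hs : Prod.fst '' r = s) (ht : Prod.snd '' r = t) :
    ∃ e : s ≃ t, (F.restrict s).IsIso (G.restrict t) e ∧ ∀ a b, (a.1, b.1) ∈ r → e a = b := by
  have hmem : ∀ p ∈ r, p.1 ∈ s ∧ p.2 ∈ t := fun p hp =>
    ⟨hs.subset ⟨p, hp, rfl⟩, ht.subset ⟨p, hp, rfl⟩⟩
  let r' : Set (s × t) := Prod.map Subtype.val Subtype.val ⁻¹' r
  have hr' : Prod.map Subtype.val Subtype.val '' r' = r :=
    Set.image_preimage_eq_of_subset fun p hp =>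
      ⟨(⟨p.1, (hmem p hp).1⟩, ⟨p.2, (hmem p hp).2⟩), rfl⟩
  have hfst : Prod.fst '' r' = Set.univ := Set.eq_univ_of_forall fun a => by
    obtain ⟨p, hp, hpa⟩ := hs.superset a.2
    exact ⟨(a, ⟨p.2, (hmem p hp).2⟩), by simpa only [r', Set.mem_preimage, Prod.map, ← hpa], rfl⟩
  have hsnd : Prod.snd '' r' = Set.univ := Set.eq_univ_of_forall fun b => by
    obtain ⟨p, hp, hpb⟩ := ht.superset b.2
    exact ⟨(⟨p.1, (hmem p hp).1⟩, b), by simpa only [r', Set.mem_preimage, Prod.map, ← hpb], rfl⟩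
  rw [← hr', ← isPartialIso_restrict_iff] at hr
  obtain ⟨e, he, hep⟩ := hr.exists_isIso hfst hsnd
  exact ⟨e, he, fun a b hab => hep (a, b) hab⟩

theorem HasExtension.isHomogeneous {F : Selector m ℕ} (hF : F.HasExtension) :
    F.IsHomogeneous := by
  intro s t e he
  obtain ⟨π, hπ, h⟩ := hF.exists_isIso_extending hF (isPartialIso_restrict_iff.1 he.isPartialIso)
    ((Set.toFinite _).image _)
  exact ⟨π, hπ, fun a => h _ ⟨(a, e a), rfl, rfl⟩⟩

theorem HasExtension.exists_isPartialIso {A B : Type*} [DecidableEq A] [DecidableEq B]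
    {F : Selector m B} (hF : F.HasExtension) (G : Selector m A) (M : Finset A) (v : Finset B) :
    ∃ r, IsPartialIso G F r ∧ r.Finite ∧ Prod.fst '' r = M ∧ Disjoint (Prod.snd '' r) v := by
  induction M using Finset.induction_on with
  | empty => exact ⟨∅, .empty G F, Set.finite_empty, by simp, by simp⟩
  | insert a s ha ih =>
    obtain ⟨r, hr, hfin, hrs, hd⟩ := ih
    obtain ⟨b, hb, h⟩ := hr.extend_right hfin hF v (a := a) (by rwa [hrs])
    refine ⟨_, h, hfin.insert _, by rw [Set.image_insert_eq, hrs, Finset.coe_insert], ?_⟩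
    rw [Set.image_insert_eq, Set.disjoint_insert_left]
    exact ⟨hb, hd⟩

theorem HasExtension.isUniversal {F : Selector m ℕ} (hF : F.HasExtension) : F.IsUniversal := by
  intro M hM G hfin
  obtain ⟨G, rfl⟩ := exists_restrict_eq G
  obtain ⟨r, hr, hrfin, hrM, hd⟩ := hF.exists_isPartialIso G M (hfin.toFinset.sup id)
  have hrt : Prod.snd '' r = (hrfin.image Prod.snd).toFinset := (Set.Finite.coe_toFinset _).symm
  obtain ⟨e, he, -⟩ := hr.exists_restrict_isIso hrM hrt
  have hle : (hrfin.image Prod.snd).toFinset ⊆ hfin.toFinset.sup id :=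
    Finset.le_sup (f := id) (hfin.mem_toFinset.2 ⟨e, he⟩)
  obtain ⟨p, hp, -⟩ := hrM.superset hM.choose_spec
  have hpr : p.2 ∈ Prod.snd '' r := ⟨p, hp, rfl⟩
  exact Set.disjoint_left.1 hd hpr (hle ((hrfin.image Prod.snd).mem_toFinset.2 hpr))

theorem IsHomogeneous.exists_aut {F : Selector m ℕ} (hF : F.IsHomogeneous) {r : Set (ℕ × ℕ)}
    (hr : IsPartialIso F F r) (hfin : r.Finite) : ∃ π ∈ F.autGroup, ∀ p ∈ r, π p.1 = p.2 := by
  obtain ⟨e, he, hep⟩ := hr.exists_restrict_isIso (hfin.image Prod.fst).coe_toFinset.symm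
    (hfin.image Prod.snd).coe_toFinset.symm
  obtain ⟨π, hπ, hπe⟩ := hF _ _ e he
  have hfst : ∀ p ∈ r, p.1 ∈ (hfin.image Prod.fst).toFinset := fun p hp =>
    (Set.Finite.mem_toFinset _).2 ⟨p, hp, rfl⟩
  have hsnd : ∀ p ∈ r, p.2 ∈ (hfin.image Prod.snd).toFinset := fun p hp =>
    (Set.Finite.mem_toFinset _).2 ⟨p, hp, rfl⟩
  exact ⟨π, hπ, fun p hp => (hπe ⟨_, hfst p hp⟩).trans
    (congrArg Subtype.val (hep _ ⟨_, hsnd p hp⟩ hp))⟩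

theorem IsUniversal.exists_isPartialIso {F : Selector m ℕ} (hF : F.IsUniversal)
    (G : Selector m ℕ) {M : Finset ℕ} (hM : M.Nonempty) :
    ∃ r, IsPartialIso G F r ∧ r.Finite ∧ ∀ a ∈ M, a ∈ Prod.fst '' r := by
  obtain ⟨s, e, he⟩ := (hF M hM (G.restrict _)).nonempty
  exact ⟨_, isPartialIso_restrict_iff.1 he.isPartialIso, (Set.toFinite _).image _,
    fun a ha => ⟨_, ⟨(⟨a, ha⟩, e ⟨a, ha⟩), rfl, rfl⟩, rfl⟩⟩

theorem Realizes.of_isPartialIso {A : Type*} [DecidableEq A] {F G : Selector m A} {r : Set (A × A)}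
    {n n₀ : A} {s : Finset A} {R : Finset A → A → Prop} {π : Equiv.Perm A}
    (hG : G.Realizes n₀ s R) (hr : IsPartialIso G F r) (hπ : π ∈ F.autGroup) (hn₀ : n₀ ∉ s)
    (hs : ∀ a ∈ s, (a, π a) ∈ r) (hn : (n₀, π n) ∈ r) : F.Realizes n s R := by
  intro t ht hm b hb
  have hnt : n₀ ∉ t := fun h => hn₀ (ht h)
  let φ := Function.update π n₀ (π n)
  have hφ : ∀ a ∈ t, φ a = π a := fun a ha =>
    Function.update_of_ne (fun h : a = n₀ => hnt (h ▸ ha)) _ _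
  have hφ₀ : φ n₀ = π n := Function.update_self _ _ _
  have himage : (insert n₀ t).image φ = (insert n t).map π.toEmbedding := by
    rw [Finset.map_eq_image, Finset.image_insert, Finset.image_insert, hφ₀]
    exact congrArg _ (Finset.image_congr hφ)
  have hφr : ∀ a ∈ insert n₀ t, (a, φ a) ∈ r := Finset.forall_mem_insert .. |>.2
    ⟨by rwa [hφ₀], fun a ha => by rw [hφ a ha]; exact hs a (ht ha)⟩
  rw [← hG t ht hm b hb, hr.picks_image_iff hφr ((Finset.card_insert_of_notMem hnt).trans hm)
    (Finset.mem_insert_of_mem hb), himage, hφ b hb, IsIso.picks_map_iff hπ]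

theorem IsUniversal.hasExtension {F : Selector m ℕ} (hF : F.IsUniversal)
    (hF' : F.IsHomogeneous) : F.HasExtension := by
  intro s R hR
  obtain ⟨n₀, hn₀⟩ := Infinite.exists_notMem_finset s
  obtain ⟨G, hGF, hGR⟩ := F.exists_realizes hR hn₀
  obtain ⟨r, hr, hfin, htotal⟩ := hF.exists_isPartialIso G (Finset.insert_nonempty n₀ s)
  have hrs : IsPartialIso F F {p ∈ r | p.1 ∈ s} :=
    (hr.mono (Set.sep_subset _ _)).congr_left fun t ht => hGF t fun a ha => by
      obtain ⟨p, hp, rfl⟩ := ht ha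
      exact hp.2
  obtain ⟨π, hπ, hπr⟩ := hF'.exists_aut hrs (hfin.subset (Set.sep_subset _ _))
  have hπ_mem : ∀ a ∈ s, (a, π a) ∈ r := fun a ha => by
    obtain ⟨p, hp, rfl⟩ := htotal a (Finset.mem_insert_of_mem ha)
    rwa [hπr p ⟨hp, ha⟩]
  obtain ⟨p, hp, rfl⟩ := htotal n₀ (Finset.mem_insert_self _ _)
  have hn : (p.1, π (π.symm p.2)) ∈ r := by rwa [π.apply_symm_apply]
  refine ⟨π.symm p.2, fun hns => hn₀ ?_, hGR.of_isPartialIso hr hπ hn₀ hπ_mem hn⟩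
  have := hr.injOn_snd (hπ_mem _ hns) hn rfl
  exact (Prod.ext_iff.1 this).1 ▸ hns

end Fraisse

/-! ### The action of the automorphism group -/

section Action

open MulAction

variable {m : ℕ} {A : Type*} [DecidableEq A] {F : Selector m A} {E : Finset A} {a b c d n : A}
  {R R' : Finset A → A → Prop} {Z : Type*} [MulAction F.autGroup Z] {x : Z}

theorem typeOf_smul_iff {g : F.autGroup} (hg : g ∈ fixingSubgroup F.autGroup (E : Set A))
    {t : Finset A} (ht : t ⊆ E) (hb : b ∈ t) : F.typeOf (g • a) t b ↔ F.typeOf a t b := by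
  rw [mem_fixingSubgroup_iff] at hg
  have hmap : (insert a t).map g.1.toEmbedding = insert (g • a) t := by
    rw [Finset.map_eq_image, Finset.image_insert]
    exact congrArg _ ((Finset.image_congr fun y hy => hg y (ht hy)).trans Finset.image_id')
  have := IsIso.picks_map_iff g.2 (s := insert a t) (a := b)
  rwa [hmap, show g.1 b = b from hg b (ht hb)] at this

theorem HasExtension.exists_smul_eq [Countable A] (hF : F.HasExtension) (ha : a ∉ E) (hn : n ∉ E)
    (h : F.Realizes n E (F.typeOf a)) : ∃ g ∈ fixingSubgroup F.autGroup (E : Set A), g • a = n := by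
  have hid : IsPartialIso F F ((fun x => (x, x)) '' (E : Set A)) :=
    (show F.IsIso F 1 from F.autGroup.one_mem).isPartialIso.mono
      (Set.image_subset_iff.2 fun x _ => rfl)
  have hr := hid.insert_pair (a := a) (b := n)
    (by simpa only [Set.image_image, Set.image_id', Finset.mem_coe] using ha)
    (by simpa only [Set.image_image, Set.image_id', Finset.mem_coe] using hn) fun u hu hm p hp => by
      obtain ⟨t, ht, rfl⟩ := Finset.subset_set_image_iff.1 hu
      obtain ⟨x, hx, rfl⟩ := Finset.mem_image.1 hp
      rw [Finset.card_image_of_injective _ fun _ _ h => (Prod.ext_iff.1 h).1] at hm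
      simp only [Finset.image_image, Function.comp_def, Finset.image_id']
      exact (h t ht hm x hx).symm
  obtain ⟨π, hπ, hπr⟩ := hF.exists_isIso_extending hF hr ((E.finite_toSet.image _).insert _)
  exact ⟨⟨π, hπ⟩, mem_fixingSubgroup_iff _ |>.2 fun x hx => hπr _ (.inr ⟨x, hx, rfl⟩),
    hπr _ (.inl rfl)⟩

theorem HasExtension.infinite_orbit [Countable A] (hF : F.HasExtension) (ha : a ∉ E) :
    (orbit (fixingSubgroup F.autGroup (E : Set A)) a).Infinite := by
  intro hfin
  obtain ⟨n, hn, hnv, hR⟩ := hF.avoiding hfin.toFinset (F.isConsistent_typeOf a E)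
  obtain ⟨g, hg, rfl⟩ := hF.exists_smul_eq ha hn hR
  exact hnv (hfin.mem_toFinset.2 ⟨⟨g, hg⟩, rfl⟩)

theorem HasExtension.exists_realizes_realizes (hF : F.HasExtension)
    (hR : IsConsistent (insert c E) R) (hR' : IsConsistent (insert d E) R') (hcd : c ≠ d)
    (hd : d ∉ E) (h : ∀ t ⊆ E, ∀ b ∈ t, R t b ↔ R' t b) :
    ∃ n, n ∉ insert c E ∧ n ∉ insert d E ∧ F.Realizes n (insert c E) R ∧
      F.Realizes n (insert d E) R' := by
  have hcons : IsConsistent (insert c E ∪ insert d E)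
      fun t b => t ⊆ insert c E ∧ R t b ∨ ¬ t ⊆ insert c E ∧ t ⊆ insert d E ∧ R' t b := by
    rintro t - x hx y hy (⟨ht, hRx⟩ | ⟨ht, htd, hRx⟩) (⟨ht', hRy⟩ | ⟨ht', -, hRy⟩)
    · exact hR t ht x hx y hy hRx hRy
    · exact absurd ht ht'
    · exact absurd ht' ht
    · exact hR' t htd x hx y hy hRx hRy
  obtain ⟨n, hn, hnR⟩ := hF _ _ hcons
  rw [Finset.notMem_union] at hn
  refine ⟨n, hn.1, hn.2, fun t ht hm b hb => ?_, fun t ht hm b hb => ?_⟩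
  · rw [hnR t (ht.trans Finset.subset_union_left) hm b hb]
    simp only [ht, true_and, not_true, false_and, or_false]
  · rw [hnR t (ht.trans Finset.subset_union_right) hm b hb]
    by_cases htc : t ⊆ insert c E
    · have htE : t ⊆ E := fun y hy => (Finset.mem_insert.1 (ht hy)).resolve_left <| by
        rintro rfl
        exact (Finset.mem_insert.1 (htc hy)).elim hcd.symm hd
      simp only [htc, true_and, not_true, false_and, or_false, h t htE b hb]
    · simp only [htc, ht, true_and, not_false_iff, false_and, false_or]

theorem HasExtension.exists_smul_eq_smul [Countable A] (hF : F.HasExtension) (ha : a ∉ E)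
    (hb : b ∉ insert a E) {k : F.autGroup} (hk : k ∈ fixingSubgroup F.autGroup (E : Set A))
    (hka : k • a ≠ a) :
    ∃ σ ∈ fixingSubgroup F.autGroup (insert a (E : Set A)),
      ∃ ρ ∈ fixingSubgroup F.autGroup (insert (k • a) (E : Set A)), σ • b = ρ • k • b := by
  have hkE : ∀ y ∉ E, k • y ∉ E := fun y hy h => hy <| by
    rwa [← smul_left_cancel k ((mem_fixingSubgroup_iff _).1 hk _ h)]
  have hkb : k • b ∉ insert (k • a) E := by
    rw [Finset.mem_insert, not_or] at hb ⊢
    exact ⟨fun h => hb.1 (smul_left_cancel k h), hkE b hb.2⟩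
  obtain ⟨n, hna, hnk, hnb, hnkb⟩ := hF.exists_realizes_realizes (F.isConsistent_typeOf b _)
    (F.isConsistent_typeOf (k • b) _) hka.symm (hkE a ha)
    fun t ht y hy => (typeOf_smul_iff hk ht hy).symm
  obtain ⟨σ, hσ, hσb⟩ := hF.exists_smul_eq hb hna hnb
  obtain ⟨ρ, hρ, hρb⟩ := hF.exists_smul_eq hkb hnk hnkb
  rw [Finset.coe_insert] at hσ hρ
  exact ⟨σ, hσ, ρ, hρ, hσb.trans hρb.symm⟩

theorem HasExtension.supports_of_smul_eq [Countable A] (hF : F.HasExtension)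
    (hx : Supports F.autGroup (insert a (E : Set A)) x) {π : F.autGroup}
    (hπ : π ∈ fixingSubgroup F.autGroup (E : Set A)) (hπx : π • x = x) (hπa : π • a ≠ a) :
    Supports F.autGroup (E : Set A) x := by
  have haE : a ∉ E := fun h => hπa ((mem_fixingSubgroup_iff _).1 hπ a h)
  have hb : π • a ∉ insert a E := by
    rw [Finset.mem_insert, not_or]
    refine ⟨hπa, fun h => hπa ?_⟩
    exact smul_left_cancel π ((mem_fixingSubgroup_iff _).1 hπ _ h)
  intro k hk
  rw [← mem_fixingSubgroup_iff] at hk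
  by_cases hka : k • a = a
  · simpa only [one_smul] using
      smul_eq_smul_of_supports_insert hx hk (one_mem _) (hka.trans (one_smul _ a).symm)
  -- `σ * π` and `ρ * k * π` both send `a` to `σ • π • a = ρ • k • π • a`, so they agree on `x`.
  obtain ⟨σ, hσ, ρ, hρ, hσρ⟩ := hF.exists_smul_eq_smul haE hb hk hka
  have hσE : σ ∈ fixingSubgroup _ (E : Set A) :=
    fixingSubgroup_antitone _ _ (Set.subset_insert _ _) hσ
  have hρE : ρ ∈ fixingSubgroup _ (E : Set A) :=
    fixingSubgroup_antitone _ _ (Set.subset_insert _ _) hρ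
  have hρa : (ρ * k) • a = k • a := by
    rw [mul_smul]
    exact (mem_fixingSubgroup_iff _).1 hρ _ (Set.mem_insert _ _)
  calc
    k • x = (ρ * k) • x := (smul_eq_smul_of_supports_insert hx (mul_mem hρE hk) hk hρa).symm
    _ = (ρ * k * π) • x := by rw [mul_smul _ π, hπx]
    _ = (σ * π) • x := (smul_eq_smul_of_supports_insert hx (mul_mem hσE hπ)
      (mul_mem (mul_mem hρE hk) hπ) (by simpa only [mul_smul] using hσρ)).symm
    _ = x := by rw [mul_smul, hπx, hx σ ((mem_fixingSubgroup_iff _).1 hσ)]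

theorem HasExtension.smul_eq_of_smul_eq [Countable A] (hF : F.HasExtension)
    (hx : Supports F.autGroup (insert a (E : Set A)) x)
    (hx' : ¬ Supports F.autGroup (E : Set A) x) {g h : F.autGroup}
    (hg : g ∈ fixingSubgroup F.autGroup (E : Set A))
    (hh : h ∈ fixingSubgroup F.autGroup (E : Set A)) (hgh : g • x = h • x) : g • a = h • a := by
  by_contra hne
  refine hx' (hF.supports_of_smul_eq hx (mul_mem (inv_mem hh) hg) ?_ ?_)
  · rw [mul_smul, hgh, inv_smul_smul]
  · rwa [mul_smul, Ne, inv_smul_eq_iff]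

end Action

end Selector

/-! ### Permutations acting on the universe of sets with atoms -/

namespace PreZFA

variable {A : Type}

theorem perm_one (x : PreZFA.{u} A) : perm 1 x = x := by
  induction x with
  | atom a => rfl
  | set ι f ih => simp only [perm, ih]

theorem perm_mul (π ρ : Equiv.Perm A) (x : PreZFA.{u} A) :
    perm (π * ρ) x = perm π (perm ρ x) := by
  induction x with
  | atom a => rfl
  | set ι f ih => simp only [perm, ih]

end PreZFA

namespace ZFA

variable {A : Type} {π : Equiv.Perm A} {x y : ZFA.{u} A}

theorem ext (hx : ¬ IsAtom x) (hy : ¬ IsAtom y) (h : ∀ z, Mem z x ↔ Mem z y) : x = y := by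
  induction x using Quotient.inductionOn with | _ x
  induction y using Quotient.inductionOn with | _ y
  cases x with
  | atom a => exact absurd trivial hx
  | set ι f =>
    cases y with
    | atom b => exact absurd trivial hy
    | set κ g =>
      refine Quotient.sound ⟨fun i => ?_, fun j => ?_⟩
      · exact (h (Quotient.mk _ (f i))).1 ⟨i, PreZFA.Equal.refl _⟩
      · obtain ⟨i, hi⟩ := (h (Quotient.mk _ (g j))).2 ⟨j, PreZFA.Equal.refl _⟩
        exact ⟨i, hi.symm⟩

theorem exists_set (S : Set (ZFA.{u} A)) [Small.{u} S] :
    ∃ x : ZFA.{u} A, ¬ IsAtom x ∧ ∀ y, Mem y x ↔ y ∈ S := by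
  let f : Shrink.{u} S → ZFA.{u} A := fun i => ((equivShrink S).symm i).1
  refine ⟨Quotient.mk _ (.set _ fun i => (f i).out), id, fun y => ?_⟩
  have hf : y ∈ S ↔ ∃ i, y = f i :=
    ⟨fun hy => ⟨equivShrink S ⟨y, hy⟩, by simp only [f, Equiv.symm_apply_apply]⟩,
      fun ⟨i, hi⟩ => hi ▸ ((equivShrink S).symm i).2⟩
  rw [hf]
  induction y using Quotient.inductionOn with | _ y
  refine exists_congr fun i => ⟨fun hi => ?_, fun hi => ?_⟩
  · exact (Quotient.sound hi).trans (Quotient.out_eq _)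
  · exact Quotient.exact (hi.trans (Quotient.out_eq _).symm)

theorem small_setOf_mem (x : ZFA.{u} A) : Small.{u} {y | Mem y x} := by
  induction x using Quotient.inductionOn with | _ x
  cases x with
  | atom a =>
    refine @small_subset _ ∅ _ (fun y hy => ?_) small_empty
    induction y using Quotient.inductionOn with | _ y
    exact hy
  | set ι f =>
    refine @small_subset _ (Set.range fun i => Quotient.mk _ (f i)) _ (fun y hy => ?_)
      (small_range _)
    induction y using Quotient.inductionOn with | _ y
    obtain ⟨i, hi⟩ := hy
    exact ⟨i, Quotient.sound hi.symm⟩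

instance : MulAction (Equiv.Perm A) (ZFA.{u} A) where
  smul := perm
  one_smul x := by
    induction x using Quotient.inductionOn with | _ x
    exact congrArg (Quotient.mk _) (PreZFA.perm_one x)
  mul_smul π ρ x := by
    induction x using Quotient.inductionOn with | _ x
    exact congrArg (Quotient.mk _) (PreZFA.perm_mul π ρ x)

theorem isAtom_smul_iff : IsAtom (π • x) ↔ IsAtom x := by
  induction x using Quotient.inductionOn with | _ x
  cases x <;> exact Iff.rfl

theorem Mem.smul (π : Equiv.Perm A) (h : Mem y x) : Mem (π • y) (π • x) := by
  induction x using Quotient.inductionOn with | _ x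
  induction y using Quotient.inductionOn with | _ y
  cases x with
  | atom a => exact h
  | set ι f =>
    obtain ⟨i, hi⟩ := h
    exact ⟨i, PreZFA.perm_congr π hi⟩

theorem mem_smul_iff : Mem y (π • x) ↔ Mem (π⁻¹ • y) x :=
  ⟨fun h => by simpa only [inv_smul_smul] using h.smul π⁻¹, fun h => by
    simpa only [smul_inv_smul] using h.smul π⟩

theorem smul_eq_self (hx : ¬ IsAtom x) (h : ∀ y, Mem (π⁻¹ • y) x ↔ Mem y x) : π • x = x :=
  ext (isAtom_smul_iff.not.2 hx) hx fun y => mem_smul_iff.trans (h y)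

variable {G : Subgroup (Equiv.Perm A)}

theorem IsSymmetric.smul (hπ : π ∈ G) (hx : IsSymmetric G x) : IsSymmetric G (π • x) := by
  obtain ⟨S, hS⟩ := hx
  refine ⟨S.map π.toEmbedding, fun ρ hρ h => ?_⟩
  have hconj : (π⁻¹ * ρ * π) • x = x := by
    refine hS _ (G.mul_mem (G.mul_mem (G.inv_mem hπ) hρ) hπ) fun a ha => ?_
    rw [Equiv.Perm.mul_apply, Equiv.Perm.mul_apply, Equiv.Perm.inv_eq_iff_eq]
    exact h (π a) (Finset.mem_map_of_mem _ ha)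
  change ρ • π • x = π • x
  rwa [mul_smul, mul_smul, inv_smul_eq_iff] at hconj

theorem IsHereditarilySymmetric.smul (hπ : π ∈ G) (hx : IsHereditarilySymmetric G x) :
    IsHereditarilySymmetric G (π • x) := by
  induction hx with
  | intro x hx _ ih =>
    refine ⟨_, hx.smul hπ, fun y hy => ?_⟩
    have := ih _ (mem_smul_iff.1 hy)
    rwa [smul_inv_smul] at this

theorem IsHereditarilySymmetric.isSymmetric (h : IsHereditarilySymmetric G x) :
    IsSymmetric G x := by
  obtain ⟨_, h, _⟩ := h
  exact h

theorem IsHereditarilySymmetric.mem (h : IsHereditarilySymmetric G x) (hy : Mem y x) :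
    IsHereditarilySymmetric G y := by
  obtain ⟨_, _, h⟩ := h
  exact h y hy

end ZFA

namespace SetAtomStructure

variable {M : Type*} [SetAtomStructure M] {p a b c d f D X : M}

theorem IsPair.inj (h : IsPair p a b) (h' : IsPair p c d) : a = c ∧ b = d ∨ a = d ∧ b = c := by
  have ha := (h'.2 a).1 ((h.2 a).2 (.inl rfl))
  have hb := (h'.2 b).1 ((h.2 b).2 (.inr rfl))
  have hc := (h.2 c).1 ((h'.2 c).2 (.inl rfl))
  have hd := (h.2 d).1 ((h'.2 d).2 (.inr rfl))
  grind

theorem IsOrderedPair.inj (h : IsOrderedPair p a b) (h' : IsOrderedPair p c d) :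
    a = c ∧ b = d := by
  obtain ⟨s, t, hs, ht, hp⟩ := h
  obtain ⟨s', t', hs', ht', hp'⟩ := h'
  rcases hp.inj hp' with ⟨rfl, rfl⟩ | ⟨rfl, rfl⟩
  · have hs := hs.inj hs'
    have ht := ht.inj ht'
    grind
  · have hs := hs.inj ht'
    have ht := ht.inj hs'
    grind

theorem Maps.mem_domain (h : Maps f a b) (hf : IsFunctionOn f D) : a ∈ D := by
  obtain ⟨p, hp, hab⟩ := h
  obtain ⟨a', b', ha', hp'⟩ := hf.2.1 p hp
  exact (hp'.inj hab).1 ▸ ha'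

theorem IsBijection.finite (hf : IsBijection f D X) (hD : {a | a ∈ D}.Finite) :
    {b | b ∈ X}.Finite := by
  obtain ⟨hfun, -, hsurj⟩ := hf
  have : Nonempty M := ⟨X⟩
  choose! φ hφ using fun b hb => (hsurj b hb).exists
  refine hD.of_injOn (f := φ) (fun b hb => (hφ b hb).mem_domain hfun) fun b hb c hc h => ?_
  exact (hfun.2.2 _ ((hφ b hb).mem_domain hfun)).unique (hφ b hb) (h ▸ hφ c hc)

theorem HasCard.nonempty {m : ℕ} (h : HasCard m X) (hm : 0 < m) : ∃ y, y ∈ X := by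
  obtain ⟨-, x, -, hx⟩ := h
  exact ⟨_, (hx _).2 ⟨⟨0, hm⟩, rfl⟩⟩

end SetAtomStructure

/-! ### Sets of the permutation model -/

namespace PermutationModel

open SetAtomStructure MulAction

variable {A : Type} {G : Subgroup (Equiv.Perm A)} {E : Finset A} {g : G} {m : ℕ}
  {a b p q x y z D X Y : PermutationModel.{u} G}

instance : MulAction G (PermutationModel.{u} G) where
  smul g x := ⟨g.1 • x.1, x.2.smul g.2⟩
  one_smul x := Subtype.ext (one_smul (Equiv.Perm A) x.1)
  mul_smul g h x := Subtype.ext (mul_smul g.1 h.1 x.1)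

theorem ext (hx : IsSet x) (hy : IsSet y) (h : ∀ z, z ∈ x ↔ z ∈ y) : x = y :=
  Subtype.ext (ZFA.ext hx hy fun z =>
    ⟨fun hz => (h ⟨z, x.2.mem hz⟩).1 hz, fun hz => (h ⟨z, y.2.mem hz⟩).2 hz⟩)

theorem mem_induction {P : PermutationModel.{u} G → Prop} (h : ∀ x, (∀ y ∈ x, P y) → P x)
    (x : PermutationModel.{u} G) : P x := by
  obtain ⟨x, hx⟩ := x
  have hx' := hx
  induction hx' with
  | intro x _ _ ih => exact h _ fun y hy => ih y.1 hy y.2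

theorem mem_smul_iff : y ∈ g • x ↔ g⁻¹ • y ∈ x :=
  ZFA.mem_smul_iff

theorem smul_mem_smul_iff : g • y ∈ g • x ↔ y ∈ x := by
  rw [mem_smul_iff, inv_smul_smul]

theorem setOf_mem_smul (g : G) (x : PermutationModel.{u} G) :
    {y | y ∈ g • x} = (g • ·) '' {y | y ∈ x} := by
  rw [Set.image_smul, ← Set.preimage_smul_inv]
  exact Set.ext fun y => mem_smul_iff

theorem isSet_smul_iff : IsSet (g • x) ↔ IsSet x :=
  ZFA.isAtom_smul_iff.not

theorem exists_supports (x : PermutationModel.{u} G) :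
    ∃ E : Finset A, Supports G (E : Set A) x := by
  obtain ⟨E, hE⟩ := x.2.isSymmetric
  exact ⟨E, fun g hg => Subtype.ext (hE g.1 g.2 fun a ha => hg ha)⟩

theorem small_setOf_mem (x : PermutationModel.{u} G) : Small.{u} {y | y ∈ x} :=
  have := ZFA.small_setOf_mem x.1
  small_of_injective <| Set.MapsTo.restrict_inj (t := {y | ZFA.Mem y x.1}) (f := Subtype.val)
    (fun _ hy => hy) |>.2 Subtype.val_injective.injOn

theorem exists_set (S : Set (PermutationModel.{u} G)) [Small.{u} S]
    (hE : ∀ g ∈ fixingSubgroup G (E : Set A), ∀ y ∈ S, g • y ∈ S) :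
    ∃ x : PermutationModel.{u} G, IsSet x ∧ Supports G (E : Set A) x ∧ ∀ y, y ∈ x ↔ y ∈ S := by
  obtain ⟨x, hx, hxS⟩ := ZFA.exists_set ((fun y : PermutationModel.{u} G => y.1) '' S)
  have hmem : ∀ g ∈ fixingSubgroup G (E : Set A), ∀ y, ZFA.Mem y x → ZFA.Mem (g.1 • y) x := by
    intro g hg y hy
    obtain ⟨z, hz, rfl⟩ := (hxS y).1 hy
    exact (hxS _).2 ⟨g • z, hE g hg z hz, rfl⟩
  have hsupp : ∀ g ∈ fixingSubgroup G (E : Set A), g.1 • x = x := fun g hg =>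
    ZFA.smul_eq_self hx fun y =>
      ⟨fun h => by simpa only [smul_inv_smul] using hmem g hg _ h, hmem g⁻¹ (inv_mem hg) y⟩
  refine ⟨⟨x, .intro x ⟨E, fun π hπ h => ?_⟩ fun y hy => ?_⟩, hx, fun g hg => ?_, fun y => ?_⟩
  · exact hsupp ⟨π, hπ⟩ ((mem_fixingSubgroup_iff _).2 h)
  · obtain ⟨z, -, rfl⟩ := (hxS y).1 hy
    exact z.2
  · exact Subtype.ext (hsupp g ((mem_fixingSubgroup_iff _).2 fun a ha => hg ha))
  · exact (hxS y.1).trans (Subtype.val_injective.mem_set_image)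

theorem exists_isPair (a b : PermutationModel.{u} G) : ∃ p, IsPair p a b := by
  classical
  obtain ⟨Ea, ha⟩ := exists_supports a
  obtain ⟨Eb, hb⟩ := exists_supports b
  obtain ⟨p, hp, -, hmem⟩ := exists_set (E := Ea ∪ Eb) {a, b} <| by
    rintro g hg _ (rfl | rfl) <;> rw [Finset.coe_union, mem_fixingSubgroup_iff] at hg
    · exact .inl (ha g fun c hc => hg _ (.inl hc))
    · exact .inr (hb g fun c hc => hg _ (.inr hc))
  exact ⟨p, hp, hmem⟩

theorem exists_isOrderedPair (a b : PermutationModel.{u} G) : ∃ p, IsOrderedPair p a b := by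
  obtain ⟨s, hs⟩ := exists_isPair a a
  obtain ⟨t, ht⟩ := exists_isPair a b
  obtain ⟨p, hp⟩ := exists_isPair s t
  exact ⟨p, s, t, hs, ht, hp⟩

theorem isPair_unique (hp : IsPair p a b) (hq : IsPair q a b) : p = q :=
  ext hp.1 hq.1 fun z => (hp.2 z).trans (hq.2 z).symm

theorem isOrderedPair_unique (hp : IsOrderedPair p a b) (hq : IsOrderedPair q a b) : p = q := by
  obtain ⟨s, t, hs, ht, hp⟩ := hp
  obtain ⟨s', t', hs', ht', hq⟩ := hq
  obtain rfl := isPair_unique hs hs'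
  obtain rfl := isPair_unique ht ht'
  exact isPair_unique hp hq

theorem isPair_smul (g : G) (hp : IsPair p a b) : IsPair (g • p) (g • a) (g • b) :=
  ⟨isSet_smul_iff.2 hp.1, fun z => by
    rw [mem_smul_iff, hp.2, inv_smul_eq_iff, inv_smul_eq_iff]⟩

theorem isOrderedPair_smul (g : G) (hp : IsOrderedPair p a b) :
    IsOrderedPair (g • p) (g • a) (g • b) := by
  obtain ⟨s, t, hs, ht, hp⟩ := hp
  exact ⟨_, _, isPair_smul g hs, isPair_smul g ht, isPair_smul g hp⟩

theorem isSubset_smul (hY : g • Y = Y) (h : IsSubset z Y) : IsSubset (g • z) Y := by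
  refine ⟨isSet_smul_iff.2 h.1, fun w hw => ?_⟩
  rw [← hY, mem_smul_iff]
  exact h.2 _ (mem_smul_iff.1 hw)

theorem hasCard_smul (g : G) (h : HasCard m z) : HasCard m (g • z) := by
  obtain ⟨hz, x, hx, h⟩ := h
  refine ⟨isSet_smul_iff.2 hz, fun i => g • x i, fun i j e => hx (smul_left_cancel g e),
    fun y => ?_⟩
  rw [mem_smul_iff, h]
  simp only [inv_smul_eq_iff]

theorem finite_of_isNatural (n : PermutationModel.{u} G) (hn : IsNatural n) :
    {y | y ∈ n}.Finite := by
  induction n using mem_induction with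
  | h n ih =>
    obtain ⟨htrans, htrans', hempty | ⟨k, hk⟩, hzs⟩ := hn
    · exact (Set.eq_empty_of_forall_notMem hempty) ▸ Set.finite_empty
    · have hkn : k ∈ n := (hk k).2 (.inr rfl)
      have hsub : ∀ y ∈ k, y ∈ n := htrans.2 k hkn
      have hfin := ih k hkn ⟨htrans' k hkn, fun y hy => htrans' y (hsub y hy), hzs k hkn,
        fun y hy => hzs y (hsub y hy)⟩
      exact (hfin.insert k).subset fun y hy => ((hk y).1 hy).symm

theorem finite_of_isFinite (hX : IsFinite X) : {y | y ∈ X}.Finite := by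
  obtain ⟨-, n, f, hn, hf⟩ := hX
  exact hf.finite (finite_of_isNatural n hn)

/-! ### Choice functions in the permutation model -/

theorem exists_isSubsetsOfCard (m : ℕ) (hY : Supports G (E : Set A) Y) :
    ∃ D : PermutationModel.{u} G, IsSubsetsOfCard m D Y ∧ Supports G (E : Set A) D := by
  have hsmall : Small.{u} {z | IsSubset z Y ∧ HasCard m z} := by
    have := small_setOf_mem Y
    refine small_of_injective (β := Set {y | y ∈ Y}) (f := fun z => {y | y.1 ∈ z.1}) fun z w h => ?_
    refine Subtype.ext (ext z.2.1.1 w.2.1.1 fun y => ⟨fun hy => ?_, fun hy => ?_⟩)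
    · exact (Set.ext_iff.1 h ⟨y, z.2.1.2 y hy⟩).1 hy
    · exact (Set.ext_iff.1 h ⟨y, w.2.1.2 y hy⟩).2 hy
  obtain ⟨D, hD, hsupp, hmem⟩ := exists_set {z | IsSubset z Y ∧ HasCard m z} (E := E)
    fun g hg z hz => ⟨isSubset_smul (hY g ((mem_fixingSubgroup_iff _).1 hg)) hz.1,
      hasCard_smul g hz.2⟩
  exact ⟨D, ⟨hD, hmem⟩, hsupp⟩

variable {C : PermutationModel.{u} G → PermutationModel.{u} G → Prop}

theorem exists_isFunctionOn (hD : Supports G (E : Set A) D)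
    (hC : ∀ g ∈ fixingSubgroup G (E : Set A), ∀ z ∈ D, ∀ y, C z y → C (g • z) (g • y))
    (hex : ∀ z ∈ D, ∃! y, C z y) :
    ∃ f : PermutationModel.{u} G, IsFunctionOn f D ∧ ∀ z y, Maps f z y ↔ z ∈ D ∧ C z y := by
  choose pair hpair using exists_isOrderedPair (G := G)
  have hsmall : Small.{u} {p | ∃ z y, z ∈ D ∧ C z y ∧ IsOrderedPair p z y} := by
    have := small_setOf_mem D
    choose c _ hc using hex
    refine @small_subset _ (Set.range fun z : {z | z ∈ D} => pair z (c z z.2)) _ ?_ (small_range _)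
    rintro p ⟨z, y, hz, hzy, hp⟩
    obtain rfl := hc z hz y hzy
    exact ⟨⟨z, hz⟩, isOrderedPair_unique (hpair _ _) hp⟩
  obtain ⟨f, hf, -, hfmem⟩ :=
      exists_set {p | ∃ z y, z ∈ D ∧ C z y ∧ IsOrderedPair p z y} (E := E) <| by
    rintro g hg p ⟨z, y, hz, hzy, hp⟩
    refine ⟨g • z, g • y, ?_, hC g hg z hz y hzy, isOrderedPair_smul g hp⟩
    rwa [← hD g ((mem_fixingSubgroup_iff _).1 hg), smul_mem_smul_iff]
  have hmaps : ∀ z y, Maps f z y ↔ z ∈ D ∧ C z y := by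
    refine fun z y => ⟨?_, fun h => ⟨_, (hfmem _).2 ⟨z, y, h.1, h.2, hpair z y⟩, hpair z y⟩⟩
    rintro ⟨p, hp, hzy⟩
    obtain ⟨z', y', hz, hC, hp'⟩ := (hfmem p).1 hp
    obtain ⟨rfl, rfl⟩ := hp'.inj hzy
    exact ⟨hz, hC⟩
  refine ⟨f, ⟨hf, fun p hp => ?_, fun z hz => ?_⟩, hmaps⟩
  · obtain ⟨z, y, hz, -, hp⟩ := (hfmem p).1 hp
    exact ⟨z, y, hz, hp⟩
  · simpa only [hmaps, hz, true_and] using hex z hz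

theorem exists_isChoiceFunction (hY : Supports G (E : Set A) Y)
    (hC : ∀ g ∈ fixingSubgroup G (E : Set A), ∀ z, IsSubset z Y → ∀ y, C z y → C (g • z) (g • y))
    (hex : ∀ z, IsSubset z Y → HasCard m z → ∃! y, C z y) (hmem : ∀ z y, C z y → y ∈ z) :
    ∃ D f : PermutationModel.{u} G, IsSubsetsOfCard m D Y ∧ IsChoiceFunction f D := by
  obtain ⟨D, hD, hDE⟩ := exists_isSubsetsOfCard m hY
  obtain ⟨f, hf, hmaps⟩ := exists_isFunctionOn hDE
    (fun g hg z hz => hC g hg z ((hD.2 z).1 hz).1)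
    fun z hz => hex z ((hD.2 z).1 hz).1 ((hD.2 z).1 hz).2
  exact ⟨D, f, hD, hf, fun z y hzy => hmem z y ((hmaps z y).1 hzy).2⟩

theorem supports_of_forall_mem (hx : IsSet x) (h : ∀ y ∈ x, Supports G (E : Set A) y) :
    Supports G (E : Set A) x := by
  refine fun g hg => ext (isSet_smul_iff.2 hx) hx fun y => ?_
  rw [mem_smul_iff]
  refine ⟨fun hy => ?_, fun hy => ?_⟩
  · rwa [← h _ hy g hg, smul_inv_smul] at hy
  · rwa [inv_smul_eq_iff.2 (h y hy g hg).symm]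

theorem exists_isChoiceFunction_of_forall_supports (hm : 0 < m) (hY : IsSet Y)
    (h : ∀ y ∈ Y, Supports G (E : Set A) y) :
    ∃ D f : PermutationModel.{u} G, IsSubsetsOfCard m D Y ∧ IsChoiceFunction f D := by
  have : Nonempty (PermutationModel.{u} G) := ⟨Y⟩
  choose! c hc using fun (z : PermutationModel.{u} G) (hz : ∃ y, y ∈ z) => hz
  refine exists_isChoiceFunction (supports_of_forall_mem hY h) (C := fun z y => y ∈ z ∧ c z = y)
    ?_ ?_ fun z y hy => hy.1
  · rintro g hg z hz _ ⟨hcz, rfl⟩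
    rw [mem_fixingSubgroup_iff] at hg
    rw [supports_of_forall_mem hz.1 (fun w hw => h w (hz.2 w hw)) g hg, h _ (hz.2 _ hcz) g hg]
    exact ⟨hcz, rfl⟩
  · exact fun z _ hz => ⟨c z, ⟨hc z (hz.nonempty hm), rfl⟩, fun y hy => hy.2.symm⟩

theorem exists_isSet_orbit (E : Finset A) (x : PermutationModel.{u} G) :
    ∃ Y : PermutationModel.{u} G, IsSet Y ∧ Supports G (E : Set A) Y ∧
      ∀ y, y ∈ Y ↔ y ∈ orbit (fixingSubgroup G (E : Set A)) x :=
  have : Small.{u} (orbit (fixingSubgroup G (E : Set A)) x) := small_range _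
  exists_set _ fun g hg _ hy => mem_orbit_of_mem_orbit (⟨g, hg⟩ : fixingSubgroup G (E : Set A)) hy

section AutGroup

variable {F : Selector m A} {E : Finset A} {Y x : PermutationModel.{u} F.autGroup}
  {φ : PermutationModel.{u} F.autGroup → A}

theorem exists_isChoiceFunction_of_injOn (hY : Supports F.autGroup (E : Set A) Y)
    (hinj : Set.InjOn φ {y | y ∈ Y})
    (hφ : ∀ g ∈ fixingSubgroup F.autGroup (E : Set A), ∀ y ∈ Y, φ (g • y) = g • φ y) :
    ∃ D f : PermutationModel.{u} F.autGroup, IsSubsetsOfCard m D Y ∧ IsChoiceFunction f D := by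
  refine exists_isChoiceFunction hY (C := fun z y => y ∈ z ∧
    ∃ T : Finset A, (T : Set A) = φ '' {w | w ∈ z} ∧ F.Picks T (φ y)) ?_ ?_ fun z y h => h.1
  · rintro g hg z hz y ⟨hy, T, hT, hpick⟩
    refine ⟨smul_mem_smul_iff.2 hy, T.map g.1.toEmbedding, ?_, ?_⟩
    · rw [Finset.coe_map, hT, setOf_mem_smul, Set.image_image, Set.image_image]
      exact Set.image_congr fun w hw => (hφ g hg w (hz.2 w hw)).symm
    · rw [hφ g hg y (hz.2 y hy)]
      exact (Selector.IsIso.picks_map_iff g.2).2 hpick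
  · rintro z hz ⟨-, v, hv, hvz⟩
    have hvY : ∀ i, v i ∈ Y := fun i => hz.2 _ ((hvz _).2 ⟨i, rfl⟩)
    let e : Fin m ↪ A := ⟨φ ∘ v, fun i j h => hv (hinj (hvY i) (hvY j) h)⟩
    have hT : ((Finset.univ.map e : Finset A) : Set A) = φ '' {w | w ∈ z} := by
      have hz_range : {w | w ∈ z} = Set.range v :=
        Set.ext fun w => (hvz w).trans (exists_congr fun i => eq_comm)
      rw [Finset.coe_map, Finset.coe_univ, Set.image_univ, hz_range, ← Set.range_comp]
      rfl
    obtain ⟨n, hpick⟩ := F.exists_picks ((Finset.card_map e).trans (Finset.card_fin m))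
    obtain ⟨i, -, rfl⟩ := Finset.mem_map.1 hpick.mem
    refine ⟨v i, ⟨(hvz _).2 ⟨i, rfl⟩, _, hT, hpick⟩, ?_⟩
    rintro y ⟨hy, T, hT', hpick'⟩
    obtain rfl := Finset.coe_injective (hT'.trans hT.symm)
    exact hinj (hz.2 y hy) (hvY i) (hpick'.unique hpick)

variable {a : A} [Countable A] [DecidableEq A]

theorem exists_orbit_coordinate (hF : F.HasExtension)
    (hx : Supports F.autGroup (insert a (E : Set A)) x)
    (hx' : ¬ Supports F.autGroup (E : Set A) x) :
    ∃ φ : PermutationModel.{u} F.autGroup → A,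
      ∀ g ∈ fixingSubgroup F.autGroup (E : Set A), φ (g • x) = g • a := by
  let K := fixingSubgroup F.autGroup (E : Set A)
  have hfac : Function.FactorsThrough (fun g : K => g • a) (fun g : K => g • x) :=
    fun g h hgh => hF.smul_eq_of_smul_eq hx hx' g.2 h.2 hgh
  exact ⟨Function.extend (fun g : K => g • x) (fun g : K => g • a) fun _ => a, fun g hg =>
    hfac.extend_apply _ ⟨g, hg⟩⟩

theorem exists_isInfinite_subset_orbit (hF : F.HasExtension)
    (hx : Supports F.autGroup (insert a (E : Set A)) x)
    (hx' : ¬ Supports F.autGroup (E : Set A) x) :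
    ∃ Y : PermutationModel.{u} F.autGroup, IsInfinite Y ∧
      (∀ y ∈ Y, y ∈ orbit (fixingSubgroup F.autGroup (E : Set A)) x) ∧
      ∃ D f, IsSubsetsOfCard m D Y ∧ IsChoiceFunction f D := by
  have haE : a ∉ E := fun ha => hx' <| by
    rwa [Set.insert_eq_of_mem (Finset.mem_coe.2 ha)] at hx
  obtain ⟨φ, hφ⟩ := exists_orbit_coordinate hF hx hx'
  obtain ⟨Y, hY, hYE, hmem⟩ := exists_isSet_orbit E x
  refine ⟨Y, ⟨hY, fun hfin => ?_⟩, fun y => (hmem y).1,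
    exists_isChoiceFunction_of_injOn hYE (φ := φ) ?_ ?_⟩
  · refine hF.infinite_orbit haE (((finite_of_isFinite hfin).image φ).subset ?_)
    rintro _ ⟨g, rfl⟩
    exact ⟨g • x, (hmem _).2 (mem_orbit x g), hφ g g.2⟩
  · intro y hy w hw hyw
    obtain ⟨g, rfl⟩ := (hmem y).1 hy
    obtain ⟨h, rfl⟩ := (hmem w).1 hw
    exact smul_eq_smul_of_supports_insert hx g.2 h.2 ((hφ g g.2).symm.trans (hyw.trans (hφ h h.2)))
  · intro g hg y hy
    obtain ⟨h, rfl⟩ := (hmem y).1 hy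
    calc
      φ (g • h.1 • x) = φ ((g * h.1) • x) := by rw [mul_smul]
      _ = g • h.1 • a := by rw [hφ _ (mul_mem hg h.2), mul_smul]
      _ = g • φ (h.1 • x) := by rw [hφ _ h.2]

theorem satisfiesRC (hF : F.HasExtension) : SatisfiesRC m (PermutationModel.{u} F.autGroup) := by
  intro X hX
  obtain ⟨S, hS⟩ := exists_supports X
  by_cases hfixed : ∀ y ∈ X, Supports F.autGroup (S : Set A) y
  · exact ⟨X, ⟨hX.1, fun _ h => h⟩, hX,
      exists_isChoiceFunction_of_forall_supports F.pos hX.1 hfixed⟩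
  · push Not at hfixed
    obtain ⟨x, hxX, hxS⟩ := hfixed
    obtain ⟨T, hT⟩ := exists_supports x
    obtain ⟨E, a, hSE, hx, hx'⟩ := exists_supports_insert hT hxS
    obtain ⟨Y, hY, hYx, hchoice⟩ := exists_isInfinite_subset_orbit hF hx hx'
    refine ⟨Y, ⟨hY.1, fun y hy => ?_⟩, hY, hchoice⟩
    obtain ⟨g, rfl⟩ := hYx y hy
    have hgX : g.1 • X = X :=
      hS g.1 fun b hb => (mem_fixingSubgroup_iff _).1 g.2 _ (Finset.coe_subset.2 hSE hb)
    rw [← hgX]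
    exact smul_mem_smul_iff.2 hxX

end AutGroup

end PermutationModel

theorem theorem2p2 (m : ℕ) (hm : 0 < m) :
    (∃ F : Selector m ℕ, F.IsUniversal ∧ F.IsHomogeneous) ∧
    ∀ F : Selector m ℕ, F.IsUniversal → F.IsHomogeneous →
      SetAtomStructure.SatisfiesRC m (PermutationModel.{u} F.autGroup) := by
  obtain ⟨F, hF⟩ := Selector.exists_hasExtension hm
  exact ⟨⟨F, hF.isUniversal, hF.isHomogeneous⟩, fun F hU hH =>
    PermutationModel.satisfiesRC (hU.hasExtension hH)⟩
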